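/- Let $s\mapsto(\xi(s),\eta(s))$, $s\in\mathbb R$, be the $C^\infty$ arc-length parametrization, periodic with period equal to the length of the curve, of a smooth strictly convex closed plane curve (a simple closed curve with nowhere vanishing curvature). Then there exists $c>0$, depending only on $\xi,\eta$, such that the following holds for every $T>0$ and every $T$-periodic $C^\infty$ function $\varphi:\mathbb R\to\mathbb R$ with $$|\dot\varphi(t)|<c,\qquad |\ddot\varphi(t)|<c\qquad\text{for all } t\in\mathbb R.$$ Let $s_1,s_2:\mathbb R\to\mathbb R$ be $C^\infty$ functions such that for all $t$ $$\xi'(s_1(t))\sin\varphi(t)+\eta'(s_1(t))\cos\varphi(t)=-1,\qquad \xi'(s_2(t))\sin\varphi(t)+\eta'(s_2(t))\cos\varphi(t)=1,\qquad s_1(t)<s_2(t)$$ (the two points of the curve, rotated by the angle $\varphi(t)$, where the tangent line is vertical). Then the equation of motion of a unit mass point sliding without friction along the rotating curve, that is, the Euler–Lagrange equation of the Lagrangian $\tfrac12\bigl(\dot s^2+\dot\varphi^2(\xi^2+\eta^2)+2\dot\varphi\dot s(\xi\eta'-\eta\xi')\bigr)+(\xi\sin\varphi+\eta\cos\varphi)$,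 $$\ddot s+\ddot\varphi\,(\xi\eta'-\eta\xi')-\dot\varphi^2(\xi\xi'+\eta\eta')-(\xi'\sin\varphi+\eta'\cos\varphi)=0$$ (with $\xi,\eta,\xi',\eta'$ evaluated at $s=s(t)$ and $\varphi,\dot\varphi,\ddot\varphi$ at $t$), has a $T$-periodic $C^\infty$ solution $s:\mathbb R\to\mathbb R$ with $$s_1(t)<s(t)<s_2(t)\qquad\text{for all } t\in\mathbb R.$$ -/

import Mathlib

open scoped ContDiff

/-- `s ↦ (ξ s, η s)` is the natural (arc length) parametrization, of period `ℓ`, of a smooth strictly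
convex closed plane curve: a smooth simple closed curve whose curvature vanishes nowhere. Both
orientations are allowed, and the origin (the centre of rotation) may lie anywhere. -/
structure IsStrictlyConvexClosedCurve (ξ η : ℝ → ℝ) (ℓ : ℝ) : Prop where
  length_pos : 0 < ℓ
  smooth_fst : ContDiff ℝ ∞ ξ
  smooth_snd : ContDiff ℝ ∞ η
  periodic_fst : Function.Periodic ξ ℓ
  periodic_snd : Function.Periodic η ℓ
  /-- The curve is simple. -/
  injOn : Set.InjOn (fun s => (ξ s, η s)) (Set.Ico 0 ℓ)
  /-- The parameter is the arc length. -/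
  unit_speed : ∀ s, deriv ξ s ^ 2 + deriv η s ^ 2 = 1
  /-- The curvature does not vanish. -/
  curvature_ne_zero :
    ∀ s, deriv ξ s * deriv (deriv η) s - deriv η s * deriv (deriv ξ) s ≠ 0

/-- The vertical component `ξ' sin φ + η' cos φ` of the unit tangent vector at the parameter `s`,
when the curve is rotated by the angle `φ`. -/
noncomputable def verticalSlope (ξ η : ℝ → ℝ) (φ s : ℝ) : ℝ :=
  deriv ξ s * Real.sin φ + deriv η s * Real.cos φ

/-- `s₁ < s₂` are smooth functions of time that give the two points of the rotating curve
where the tangent line is vertical: the vertical component of the unit tangent vector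
is `-1` at `s₁ t` and `1` at `s₂ t`. -/
structure IsVerticalTangentPair (ξ η φ s₁ s₂ : ℝ → ℝ) : Prop where
  smooth_left : ContDiff ℝ ∞ s₁
  smooth_right : ContDiff ℝ ∞ s₂
  left_eq : ∀ t, verticalSlope ξ η (φ t) (s₁ t) = -1
  right_eq : ∀ t, verticalSlope ξ η (φ t) (s₂ t) = 1
  lt : ∀ t, s₁ t < s₂ t

/-- `s` is a (smooth, global) solution of the equation of motion of a unit mass point on
the rotating curve under unit gravity. This is the Euler-Lagrange equation of `K - V`, where
`K = (s'² + φ'² (ξ² + η²) + 2 φ' s' (ξ η' - η ξ')) / 2` is the kinetic energy and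
`V = -(ξ sin φ + η cos φ)` is the potential. -/
def IsRotatingCurveSolution (ξ η φ s : ℝ → ℝ) : Prop :=
  ContDiff ℝ ∞ s ∧
    ∀ t, deriv (deriv s) t
        + deriv (deriv φ) t * (ξ (s t) * deriv η (s t) - η (s t) * deriv ξ (s t))
        - deriv φ t ^ 2 * (ξ (s t) * deriv ξ (s t) + η (s t) * deriv η (s t))
        - verticalSlope ξ η (φ t) (s t) = 0

/-! The equation reads `s'' = f t s`, where `f` is the vertical slope plus terms of size `φ''` and
`φ'^2`. The slope is `-1` at `s₁` and `1` at `s₂`, and for slow rotation `s₁''` and `s₂''` are small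
as well. Hence `s₁'' > f t s₁` and `s₂'' < f t s₂`: `s₁` is a strict lower and `s₂` a strict upper
solution, and a periodic solution lies between them.

The solution is found by monotone iteration (`exists_periodic_solution_between`). For `m` large, `m²
x - f t x` increases in `x`, and the inverse of `-d²/dt² + m²` on periodic functions has a
nonnegative kernel. The resulting map preserves order, so its iterates from `s₁` increase to a fixed
point.

The geometry enters through the tangent angle: its sum with `φ` is constant along `s₁` and along
`s₂`. Nonzero curvature then gives their periodicity (`periodic_of_verticalSlope_eq`) and the bound
on their accelerations. -/

open MeasureTheory intervalIntegral Filter Topology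

/-! ### Periodic Green operator -/

/-- The `T`-periodic Green kernel of `-u'' + m² u`. -/
noncomputable def greenKernel (m T r : ℝ) : ℝ :=
  (Real.exp (-m * r) + Real.exp (-m * (T - r))) / (2 * m * (1 - Real.exp (-m * T)))

/-- The operator solving `-u'' + m² u = h` for `T`-periodic functions. -/
noncomputable def greenOperator (m T : ℝ) (h : ℝ → ℝ) (t : ℝ) : ℝ :=
  ∫ r in (0 : ℝ)..T, greenKernel m T r * h (t + r)

theorem one_sub_exp_pos {m T : ℝ} (hm : 0 < m) (hT : 0 < T) : 0 < 1 - Real.exp (-m * T) := by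
  have : Real.exp (-m * T) < 1 := by
    rw [← Real.exp_zero, Real.exp_lt_exp]; nlinarith [mul_pos hm hT]
  linarith

theorem greenKernel_nonneg {m T : ℝ} (hm : 0 < m) (hT : 0 < T) (r : ℝ) :
    0 ≤ greenKernel m T r := by
  have := one_sub_exp_pos hm hT
  unfold greenKernel
  positivity

theorem continuous_greenKernel (m T : ℝ) : Continuous (greenKernel m T) := by
  unfold greenKernel
  fun_prop

theorem greenOperator_periodic {m T : ℝ} {h : ℝ → ℝ} (hp : Function.Periodic h T) :
    Function.Periodic (greenOperator m T h) T := by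
  intro t
  unfold greenOperator
  congr 1
  ext r
  rw [show t + T + r = t + r + T by ring, hp]

theorem intervalIntegrable_greenKernel_mul {m T : ℝ} {h : ℝ → ℝ}
    (hh : ∀ a b, IntervalIntegrable h volume a b) (t : ℝ) :
    IntervalIntegrable (fun r => greenKernel m T r * h (t + r)) volume 0 T := by
  have h1 : IntervalIntegrable (fun r => h (t + r)) volume 0 T := by
    simpa using (hh t (t + T)).comp_add_left t
  exact h1.continuousOn_mul (continuous_greenKernel m T).continuousOn

theorem greenOperator_mono {m T : ℝ} (hm : 0 < m) (hT : 0 < T) {h k : ℝ → ℝ}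
    (hh : ∀ a b, IntervalIntegrable h volume a b) (hk : ∀ a b, IntervalIntegrable k volume a b)
    (hle : ∀ t, h t ≤ k t) (t : ℝ) : greenOperator m T h t ≤ greenOperator m T k t :=
  integral_mono_on hT.le (intervalIntegrable_greenKernel_mul hh t)
    (intervalIntegrable_greenKernel_mul hk t)
    fun r _ => mul_le_mul_of_nonneg_left (hle _) (greenKernel_nonneg hm hT r)

theorem intervalIntegrable_exp_mul {h : ℝ → ℝ} (hh : ∀ a b, IntervalIntegrable h volume a b)
    (c a b : ℝ) : IntervalIntegrable (fun τ => Real.exp (c * τ) * h τ) volume a b :=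
  (hh a b).continuousOn_mul (Continuous.continuousOn (by fun_prop))

/-- Splitting the exponentials pulls `t` out of the integrals and leaves primitives of fixed
functions. This gives continuity for merely integrable `h`, and derivatives when `h` is continuous.
-/
theorem greenOperator_eq {m T : ℝ} {h : ℝ → ℝ} (hh : ∀ a b, IntervalIntegrable h volume a b)
    (t : ℝ) :
    greenOperator m T h t =
      (Real.exp (m * t) * ((∫ τ in (0 : ℝ)..t + T, Real.exp (-m * τ) * h τ) -
          ∫ τ in (0 : ℝ)..t, Real.exp (-m * τ) * h τ) +
        Real.exp (-m * T) * Real.exp (-m * t) *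
          ((∫ τ in (0 : ℝ)..t + T, Real.exp (m * τ) * h τ) -
            ∫ τ in (0 : ℝ)..t, Real.exp (m * τ) * h τ)) /
        (2 * m * (1 - Real.exp (-m * T))) := by
  have key : greenOperator m T h t =
      ∫ τ in t..t + T, (Real.exp (m * t) * (Real.exp (-m * τ) * h τ) +
        Real.exp (-m * T) * Real.exp (-m * t) * (Real.exp (m * τ) * h τ)) /
          (2 * m * (1 - Real.exp (-m * T))) := by
    have := integral_comp_add_left (a := 0) (b := T)
      (fun τ => (Real.exp (m * t) * (Real.exp (-m * τ) * h τ) +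
        Real.exp (-m * T) * Real.exp (-m * t) * (Real.exp (m * τ) * h τ)) /
          (2 * m * (1 - Real.exp (-m * T)))) t
    rw [add_zero] at this
    rw [← this]
    unfold greenOperator greenKernel
    congr 1
    ext r
    have e1 : Real.exp (-m * r) = Real.exp (m * t) * Real.exp (-m * (t + r)) := by
      rw [← Real.exp_add]; ring_nf
    have e2 : Real.exp (-m * (T - r)) =
        Real.exp (-m * T) * Real.exp (-m * t) * Real.exp (m * (t + r)) := by
      rw [← Real.exp_add, ← Real.exp_add]; ring_nf
    rw [e1, e2]
    ring
  rw [key, intervalIntegral.integral_div, intervalIntegral.integral_add,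
    intervalIntegral.integral_const_mul, intervalIntegral.integral_const_mul,
    integral_interval_sub_left, integral_interval_sub_left]
  any_goals exact intervalIntegrable_exp_mul hh _ _ _
  all_goals exact (intervalIntegrable_exp_mul hh _ _ _).const_mul _

theorem continuous_greenOperator {m T : ℝ} {h : ℝ → ℝ}
    (hh : ∀ a b, IntervalIntegrable h volume a b) : Continuous (greenOperator m T h) := by
  have hc (c : ℝ) : Continuous fun t => ∫ τ in (0 : ℝ)..t, Real.exp (c * τ) * h τ :=
    continuous_primitive (intervalIntegrable_exp_mul hh c) 0
  have hc' (c : ℝ) : Continuous fun t => ∫ τ in (0 : ℝ)..t + T, Real.exp (c * τ) * h τ :=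
    (hc c).comp (continuous_id.add continuous_const)
  rw [funext (greenOperator_eq (m := m) (T := T) hh)]
  have h1 := hc m
  have h2 := hc' m
  have h3 := hc (-m)
  have h4 := hc' (-m)
  fun_prop

theorem hasDerivAt_greenOperator {m T : ℝ} (hm : 0 < m) (hT : 0 < T) {h : ℝ → ℝ}
    (hc : Continuous h) (hp : Function.Periodic h T) :
    ∃ v : ℝ → ℝ, (∀ t, HasDerivAt (greenOperator m T h) (v t) t) ∧
      ∀ t, HasDerivAt v (m ^ 2 * greenOperator m T h t - h t) t := by
  have hq := one_sub_exp_pos hm hT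
  have hh : ∀ a b, IntervalIntegrable h volume a b := fun a b => hc.intervalIntegrable a b
  have hprim (c t : ℝ) : HasDerivAt (fun t => ∫ τ in (0 : ℝ)..t, Real.exp (c * τ) * h τ)
      (Real.exp (c * t) * h t) t :=
    integral_hasDerivAt_right (intervalIntegrable_exp_mul hh c _ _)
      (Continuous.stronglyMeasurableAtFilter (by fun_prop) _ _)
      (Continuous.continuousAt (by fun_prop))
  have hprim' (c t : ℝ) : HasDerivAt (fun t => ∫ τ in (0 : ℝ)..t + T, Real.exp (c * τ) * h τ)
      (Real.exp (c * (t + T)) * h t) t := by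
    have := (hprim c (t + T)).comp_add_const t T
    rwa [hp] at this
  have hexp (c t : ℝ) : HasDerivAt (fun t => Real.exp (c * t)) (c * Real.exp (c * t)) t := by
    simpa [mul_comm] using ((hasDerivAt_id t).const_mul c).exp
  -- The velocity is the same expression with a minus between the two exponential parts. The
  -- boundary terms cancel in the first derivative and add up to `-h` in the second.
  refine ⟨fun t => m * (Real.exp (m * t) * ((∫ τ in (0 : ℝ)..t + T, Real.exp (-m * τ) * h τ) -
          ∫ τ in (0 : ℝ)..t, Real.exp (-m * τ) * h τ) -
        Real.exp (-m * T) * Real.exp (-m * t) *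
          ((∫ τ in (0 : ℝ)..t + T, Real.exp (m * τ) * h τ) -
            ∫ τ in (0 : ℝ)..t, Real.exp (m * τ) * h τ)) /
        (2 * m * (1 - Real.exp (-m * T))), fun t => ?_, fun t => ?_⟩
  · rw [funext (greenOperator_eq (m := m) (T := T) hh)]
    refine ((((hexp m t).mul ((hprim' (-m) t).sub (hprim (-m) t))).add
      (((hexp (-m) t).const_mul (Real.exp (-m * T))).mul
        ((hprim' m t).sub (hprim m t)))).div_const
          (2 * m * (1 - Real.exp (-m * T)))).congr_deriv ?_
    have e1 : Real.exp (m * (t + T)) = Real.exp (m * t) * Real.exp (m * T) := by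
      rw [← Real.exp_add]; ring_nf
    have e2 : Real.exp (-m * (t + T)) = Real.exp (-m * t) * Real.exp (-m * T) := by
      rw [← Real.exp_add]; ring_nf
    have e3 : Real.exp (-m * T) * Real.exp (m * T) = 1 := by
      rw [← Real.exp_add]; simp
    simp only [Pi.sub_apply]
    rw [e1, e2]
    congr 1
    linear_combination (Real.exp (-m * t) * Real.exp (m * t) * h t) * e3
  · rw [greenOperator_eq hh]
    refine (((((hexp m t).mul ((hprim' (-m) t).sub (hprim (-m) t))).sub
      (((hexp (-m) t).const_mul (Real.exp (-m * T))).mul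
        ((hprim' m t).sub (hprim m t)))).const_mul m).div_const
          (2 * m * (1 - Real.exp (-m * T)))).congr_deriv ?_
    have e1 : Real.exp (m * (t + T)) = Real.exp (m * t) * Real.exp (m * T) := by
      rw [← Real.exp_add]; ring_nf
    have e2 : Real.exp (-m * (t + T)) = Real.exp (-m * t) * Real.exp (-m * T) := by
      rw [← Real.exp_add]; ring_nf
    have e3 : Real.exp (-m * T) * Real.exp (m * T) = 1 := by
      rw [← Real.exp_add]; simp
    have e4 : Real.exp (-m * t) * Real.exp (m * t) = 1 := by
      rw [← Real.exp_add]; simp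
    simp only [Pi.sub_apply]
    rw [e1, e2]
    generalize Real.exp (-m * T) = q at *
    generalize Real.exp (m * T) = q' at *
    generalize Real.exp (-m * t) = p at *
    generalize Real.exp (m * t) = p' at *
    have hq0 : 1 - q ≠ 0 := hq.ne'
    field_simp
    linear_combination (-h t * p * p') * e3 - (2 * h t * (1 - q)) * e4

/-! ### Maximum principle and lower and upper solutions -/

/-- At a maximum with nonnegative value the second derivative would be positive, making the point
also a local minimum. Then `z` is locally constant there, so its second derivative vanishes, a
contradiction. -/
theorem neg_of_periodic_of_mul_lt_deriv2 {T M : ℝ} (hT : 0 < T) (hM : 0 ≤ M) {z z₁ z₂ : ℝ → ℝ}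
    (hz : ∀ t, HasDerivAt z (z₁ t) t) (hz₁ : ∀ t, HasDerivAt z₁ (z₂ t) t)
    (hp : Function.Periodic z T) (h : ∀ t, M * z t < z₂ t) (t : ℝ) : z t < 0 := by
  have hc : Continuous z := continuous_iff_continuousAt.2 fun t => (hz t).continuousAt
  obtain ⟨t₀, -, hmax⟩ := isCompact_Icc.exists_isMaxOn (Set.nonempty_Icc.2 hT.le)
    (hc.continuousOn (s := Set.Icc 0 T))
  have hle : ∀ s, z s ≤ z t₀ := fun s => by
    obtain ⟨y, hy, hys⟩ := hp.exists_mem_Ico₀ hT s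
    rw [hys]
    exact hmax ⟨hy.1, hy.2.le⟩
  refine (hle t).trans_lt ?_
  by_contra! h0
  have hd1 : deriv z = z₁ := funext fun t => (hz t).deriv
  have hd2 : deriv (deriv z) t₀ = z₂ t₀ := by rw [hd1]; exact (hz₁ t₀).deriv
  have hpos : 0 < deriv (deriv z) t₀ := by
    rw [hd2]; exact (mul_nonneg hM h0).trans_lt (h t₀)
  have hlmax : IsLocalMax z t₀ := Eventually.of_forall hle
  have hmin := isLocalMin_of_deriv_deriv_pos hpos hlmax.deriv_eq_zero hc.continuousAt
  have heq : z =ᶠ[𝓝 t₀] fun _ => z t₀ := hmin.mono fun s hs => le_antisymm (hle s) hs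
  have := heq.deriv.deriv_eq
  simp at this
  exact hpos.ne' this

/-- One step of the monotone iteration for `u'' = f t u`. -/
noncomputable def iterationStep (m T : ℝ) (f : ℝ → ℝ → ℝ) (u : ℝ → ℝ) : ℝ → ℝ :=
  greenOperator m T fun t => m ^ 2 * u t - f t (u t)

theorem contDiff_infty_of_hasDerivAt {f : ℝ → ℝ → ℝ} (hf : ContDiff ℝ ∞ (Function.uncurry f))
    {u v : ℝ → ℝ} (hu : ∀ t, HasDerivAt u (v t) t) (hv : ∀ t, HasDerivAt v (f t (u t)) t) :
    ContDiff ℝ ∞ u := by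
  rw [contDiff_infty]
  have hdu : deriv u = v := funext fun t => (hu t).deriv
  have hdv : deriv v = fun t => f t (u t) := funext fun t => (hv t).deriv
  suffices ∀ n : ℕ, ContDiff ℝ n u ∧ ContDiff ℝ n v from fun n => (this n).1
  intro n
  induction n with
  | zero =>
    exact ⟨contDiff_zero.2 (continuous_iff_continuousAt.2 fun t => (hu t).continuousAt),
      contDiff_zero.2 (continuous_iff_continuousAt.2 fun t => (hv t).continuousAt)⟩
  | succ n ih =>
    push_cast
    refine ⟨contDiff_succ_iff_deriv.2 ⟨fun t => (hu t).differentiableAt, by simp, ?_⟩,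
      contDiff_succ_iff_deriv.2 ⟨fun t => (hv t).differentiableAt, by simp, ?_⟩⟩
    · rw [hdu]; exact ih.2
    · rw [hdv]
      exact (hf.of_le (by exact_mod_cast le_top)).comp (contDiff_id.prodMk ih.1)

/-- The method of lower and upper solutions for the periodic problem `u'' = f t u`. -/
theorem exists_periodic_solution_between {m T : ℝ} (hm : 0 < m) (hT : 0 < T) {f : ℝ → ℝ → ℝ}
    (hf : ContDiff ℝ ∞ (Function.uncurry f)) (hfp : ∀ t x, f (t + T) x = f t x)
    (hfm : ∀ t, Monotone fun x => m ^ 2 * x - f t x)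
    {α α₁ α₂ β β₁ β₂ : ℝ → ℝ}
    (hα : ∀ t, HasDerivAt α (α₁ t) t) (hα₁ : ∀ t, HasDerivAt α₁ (α₂ t) t)
    (hβ : ∀ t, HasDerivAt β (β₁ t) t) (hβ₁ : ∀ t, HasDerivAt β₁ (β₂ t) t)
    (hαp : Function.Periodic α T) (hβp : Function.Periodic β T)
    (hαf : ∀ t, f t (α t) < α₂ t) (hβf : ∀ t, β₂ t < f t (β t)) (hαβ : ∀ t, α t ≤ β t) :
    ∃ u : ℝ → ℝ, ContDiff ℝ ∞ u ∧ (∀ t, deriv (deriv u) t = f t (u t)) ∧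
      Function.Periodic u T ∧ ∀ t, α t < u t ∧ u t < β t := by
  have hfc : Continuous (Function.uncurry f) := hf.continuous
  set S := iterationStep m T f
  have hFc {u : ℝ → ℝ} (hu : Continuous u) : Continuous fun t => m ^ 2 * u t - f t (u t) :=
    (continuous_const.mul hu).sub (hfc.comp (continuous_id.prodMk hu))
  have hFp {u : ℝ → ℝ} (hu : Function.Periodic u T) :
      Function.Periodic (fun t => m ^ 2 * u t - f t (u t)) T := fun t => by
    simp only [hu t, hfp]
  have hSp {u : ℝ → ℝ} (hu : Function.Periodic u T) : Function.Periodic (S u) T :=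
    greenOperator_periodic (hFp hu)
  have hαc : Continuous α := continuous_iff_continuousAt.2 fun t => (hα t).continuousAt
  have hβc : Continuous β := continuous_iff_continuousAt.2 fun t => (hβ t).continuousAt
  -- Only measurability is assumed, since the limit of the iterates is not yet known to be
  -- continuous. By `hfm` the integrand lies between its values at `α` and `β`.
  have hint {u : ℝ → ℝ} (hu : Measurable u) (h1 : ∀ t, α t ≤ u t) (h2 : ∀ t, u t ≤ β t) :
      ∀ a b, IntervalIntegrable (fun t => m ^ 2 * u t - f t (u t)) volume a b := fun a b => by
    have hb : Continuous fun t => |m ^ 2 * α t - f t (α t)| + |m ^ 2 * β t - f t (β t)| :=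
      (hFc hαc).abs.add (hFc hβc).abs
    refine (hb.intervalIntegrable a b).mono_fun
      ((measurable_const.mul hu).sub
        (hfc.measurable.comp (measurable_id.prodMk hu))).aestronglyMeasurable
      (Eventually.of_forall fun t => ?_)
    have e1 := hfm t (h1 t)
    have e2 := hfm t (h2 t)
    simp only [Real.norm_eq_abs] at e1 e2 ⊢
    rw [abs_of_nonneg (a := _ + _) (by positivity)]
    refine abs_le.2 ⟨?_, ?_⟩
    · linarith [neg_abs_le (m ^ 2 * α t - f t (α t)), abs_nonneg (m ^ 2 * β t - f t (β t))]
    · linarith [le_abs_self (m ^ 2 * β t - f t (β t)), abs_nonneg (m ^ 2 * α t - f t (α t))]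
  have hSmono {u w : ℝ → ℝ} (hu : Measurable u) (hw : Measurable w) (h1 : ∀ t, α t ≤ u t)
      (huw : ∀ t, u t ≤ w t) (h2 : ∀ t, w t ≤ β t) (t : ℝ) : S u t ≤ S w t :=
    greenOperator_mono hm hT (hint hu h1 fun t => (huw t).trans (h2 t))
      (hint hw (fun t => (h1 t).trans (huw t)) h2) (fun t => hfm t (huw t)) t
  -- The difference `z = α - S α` satisfies `z'' - m² z = α₂ - f t α > 0`, so the maximum principle
  -- applies.
  have hSα : ∀ t, α t < S α t := by
    obtain ⟨v, hv, hv₁⟩ := hasDerivAt_greenOperator hm hT (hFc hαc) (hFp hαp)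
    have := neg_of_periodic_of_mul_lt_deriv2 (M := m ^ 2) hT (by positivity)
      (fun t => (hα t).sub (hv t)) (fun t => (hα₁ t).sub (hv₁ t)) (hαp.sub (hSp hαp))
      (fun t => by simp only [Pi.sub_apply]; linarith [hαf t])
    exact fun t => sub_neg.1 (this t)
  have hSβ : ∀ t, S β t < β t := by
    obtain ⟨v, hv, hv₁⟩ := hasDerivAt_greenOperator hm hT (hFc hβc) (hFp hβp)
    have := neg_of_periodic_of_mul_lt_deriv2 (M := m ^ 2) hT (by positivity)
      (fun t => (hv t).sub (hβ t)) (fun t => (hv₁ t).sub (hβ₁ t)) ((hSp hβp).sub hβp)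
      (fun t => by simp only [Pi.sub_apply]; linarith [hβf t])
    exact fun t => sub_neg.1 (this t)
  let a : ℕ → ℝ → ℝ := fun n => S^[n] α
  have ha0 : a 0 = α := rfl
  have has (n : ℕ) : a (n + 1) = S (a n) := Function.iterate_succ_apply' S n α
  have inv (n : ℕ) : Continuous (a n) ∧ Function.Periodic (a n) T ∧ (∀ t, α t ≤ a n t) ∧
      (∀ t, a n t ≤ β t) ∧ ∀ t, a n t ≤ a (n + 1) t := by
    induction n with
    | zero => exact ⟨hαc, hαp, fun t => le_rfl, hαβ, fun t => by rw [has, ha0]; exact (hSα t).le⟩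
    | succ n ih =>
      obtain ⟨hc, hp, h1, h2, h3⟩ := ih
      have hc' : Continuous (a (n + 1)) := by
        rw [has]; exact continuous_greenOperator (hint hc.measurable h1 h2)
      have h2' : ∀ t, a (n + 1) t ≤ β t := fun t => by
        rw [has]
        exact (hSmono hc.measurable hβc.measurable h1 h2 (fun t => le_rfl) t).trans (hSβ t).le
      refine ⟨hc', by rw [has]; exact hSp hp, fun t => (h1 t).trans (h3 t), h2', fun t => ?_⟩
      rw [has (n + 1)]
      nth_rewrite 1 [has n]
      exact hSmono hc.measurable hc'.measurable h1 h3 h2' t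
  have hbdd (t : ℝ) : BddAbove (Set.range fun n => a n t) :=
    ⟨β t, by rintro _ ⟨n, rfl⟩; exact (inv n).2.2.2.1 t⟩
  let u : ℝ → ℝ := fun t => ⨆ n, a n t
  have hlim (t : ℝ) : Tendsto (fun n => a n t) atTop (𝓝 (u t)) :=
    tendsto_atTop_ciSup (monotone_nat_of_le_succ fun n => (inv n).2.2.2.2 t) (hbdd t)
  have hau (n : ℕ) (t : ℝ) : a n t ≤ u t := le_ciSup (hbdd t) n
  have huβ (t : ℝ) : u t ≤ β t := ciSup_le fun n => (inv n).2.2.2.1 t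
  have hum : Measurable u := measurable_of_tendsto_metrizable
    (fun n => (inv n).1.measurable) (tendsto_pi_nhds.2 hlim)
  have hup : Function.Periodic u T := fun t => by
    simp only [u, fun n => (inv n).2.1 t]
  have hαu (t : ℝ) : α t ≤ u t := hau 0 t
  have hfix : S u = u := by
    funext t
    have h1 : Tendsto (fun n => S (a n) t) atTop (𝓝 (u t)) := by
      simp only [← has]
      exact (tendsto_add_atTop_iff_nat 1).2 (hlim t)
    refine tendsto_nhds_unique ?_ h1
    have hb : Continuous fun r => greenKernel m T r *
        (|m ^ 2 * α (t + r) - f (t + r) (α (t + r))| +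
          |m ^ 2 * β (t + r) - f (t + r) (β (t + r))|) :=
      (continuous_greenKernel m T).mul
        ((((hFc hαc).abs.add (hFc hβc).abs)).comp (continuous_const.add continuous_id))
    refine tendsto_integral_filter_of_dominated_convergence _
      (Eventually.of_forall fun n => ?_) (Eventually.of_forall fun n =>
        Eventually.of_forall fun r _ => ?_) (hb.intervalIntegrable 0 T)
      (Eventually.of_forall fun r _ => ?_)
    · exact ((continuous_greenKernel m T).mul
        ((hFc (inv n).1).comp (continuous_const.add continuous_id))).aestronglyMeasurable
    · have e1 := hfm (t + r) ((inv n).2.2.1 (t + r))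
      have e2 := hfm (t + r) ((inv n).2.2.2.1 (t + r))
      simp only at e1 e2
      rw [norm_mul, Real.norm_eq_abs, Real.norm_eq_abs,
        abs_of_nonneg (greenKernel_nonneg hm hT r)]
      refine mul_le_mul_of_nonneg_left (abs_le.2 ⟨?_, ?_⟩) (greenKernel_nonneg hm hT r)
      · linarith [neg_abs_le (m ^ 2 * α (t + r) - f (t + r) (α (t + r))),
          abs_nonneg (m ^ 2 * β (t + r) - f (t + r) (β (t + r)))]
      · linarith [le_abs_self (m ^ 2 * β (t + r) - f (t + r) (β (t + r))),
          abs_nonneg (m ^ 2 * α (t + r) - f (t + r) (α (t + r)))]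
    · have hcx : Continuous fun x => m ^ 2 * x - f (t + r) x :=
        (continuous_const.mul continuous_id).sub
          (hfc.comp (continuous_const.prodMk continuous_id))
      exact ((hcx.tendsto _).comp (hlim (t + r))).const_mul _
  -- The fixed-point identity upgrades `u` from measurable to continuous, and then to twice
  -- differentiable.
  have huc : Continuous u := by
    rw [← hfix]; exact continuous_greenOperator (hint hum hαu huβ)
  obtain ⟨v, hv, hv₁⟩ := hasDerivAt_greenOperator hm hT (hFc huc) (hFp hup)
  have hfix' : greenOperator m T (fun t => m ^ 2 * u t - f t (u t)) = u := hfix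
  rw [hfix'] at hv hv₁
  have hv₂ (t : ℝ) : HasDerivAt v (f t (u t)) t := by
    have := hv₁ t
    rwa [sub_sub_cancel] at this
  refine ⟨u, contDiff_infty_of_hasDerivAt hf hv hv₂, fun t => ?_, hup, fun t => ⟨?_, ?_⟩⟩
  · rw [show deriv u = v from funext fun t => (hv t).deriv, (hv₂ t).deriv]
  · calc α t < S α t := hSα t
      _ ≤ u t := hau 1 t
  · calc u t = S u t := by rw [hfix]
      _ ≤ S β t := hSmono hum hβc.measurable hαu huβ (fun t => le_rfl) t
      _ < β t := hSβ t

/-! ### Calculus of smooth periodic functions -/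

theorem Function.Periodic.deriv_periodic {f : ℝ → ℝ} {c : ℝ} (hf : Function.Periodic f c) :
    Function.Periodic (deriv f) c := fun x => by
  rw [← deriv_comp_add_const, funext hf]

theorem Function.Periodic.exists_abs_le {f : ℝ → ℝ} {c : ℝ} (hf : Function.Periodic f c)
    (hc : c ≠ 0) (hcont : Continuous f) : ∃ B, ∀ x, |f x| ≤ B := by
  obtain ⟨B, hB⟩ := (hf.isBounded_of_continuous hc hcont).exists_norm_le
  exact ⟨B, fun x => hB _ ⟨x, rfl⟩⟩

theorem ContDiff.deriv_infty {f : ℝ → ℝ} (hf : ContDiff ℝ ∞ f) : ContDiff ℝ ∞ (deriv f) :=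
  (contDiff_infty_iff_deriv.1 hf).2

theorem ContDiff.hasDerivAt_infty {f : ℝ → ℝ} (hf : ContDiff ℝ ∞ f) (t : ℝ) :
    HasDerivAt f (deriv f t) t :=
  ((contDiff_infty_iff_deriv.1 hf).1 t).hasDerivAt

theorem abs_sub_le_of_abs_deriv_le {f : ℝ → ℝ} {B : ℝ} (hf : ContDiff ℝ ∞ f)
    (hB : ∀ x, |deriv f x| ≤ B) {x y : ℝ} (hxy : x ≤ y) : |f y - f x| ≤ B * (y - x) := by
  have := convex_univ.norm_image_sub_le_of_norm_deriv_le (f := f)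
    (fun z _ => (hf.hasDerivAt_infty z).differentiableAt) (fun z _ => hB z)
    (Set.mem_univ x) (Set.mem_univ y)
  rwa [Real.norm_eq_abs, Real.norm_eq_abs, abs_of_nonneg (sub_nonneg.2 hxy)] at this

theorem injective_of_deriv_ne_zero {θ : ℝ → ℝ} (hθ : Continuous (deriv θ))
    (h : ∀ s, deriv θ s ≠ 0) : Function.Injective θ := by
  by_cases h0 : 0 < deriv θ 0
  · refine (strictMono_of_deriv_pos fun x => ?_).injective
    by_contra! hx
    obtain ⟨y, hy⟩ := mem_range_of_exists_le_of_exists_ge hθ ⟨x, hx⟩ ⟨0, h0.le⟩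
    exact h y hy
  · refine (strictAnti_of_deriv_neg fun x => ?_).injective
    by_contra! hx
    obtain ⟨y, hy⟩ := mem_range_of_exists_le_of_exists_ge hθ ⟨0, not_lt.1 h0⟩ ⟨x, hx⟩
    exact h y hy

/-! ### Curvature and the points of vertical tangency -/

/-- The signed curvature of a curve parametrized by arc length. -/
noncomputable def curvature (ξ η : ℝ → ℝ) (s : ℝ) : ℝ :=
  deriv ξ s * deriv (deriv η) s - deriv η s * deriv (deriv ξ) s

/-- The right-hand side of the equation of motion `s'' = f t s`. -/
noncomputable def motionForce (ξ η φ : ℝ → ℝ) (t x : ℝ) : ℝ :=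
  verticalSlope ξ η (φ t) x
    - deriv (deriv φ) t * (ξ x * deriv η x - η x * deriv ξ x)
    + deriv φ t ^ 2 * (ξ x * deriv ξ x + η x * deriv η x)

section

variable {ξ η φ s : ℝ → ℝ} {ℓ σ : ℝ}

theorem IsStrictlyConvexClosedCurve.contDiff_curvature (h : IsStrictlyConvexClosedCurve ξ η ℓ) :
    ContDiff ℝ ∞ (curvature ξ η) :=
  (h.smooth_fst.deriv_infty.mul h.smooth_snd.deriv_infty.deriv_infty).sub
    (h.smooth_snd.deriv_infty.mul h.smooth_fst.deriv_infty.deriv_infty)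

theorem IsStrictlyConvexClosedCurve.curvature_periodic (h : IsStrictlyConvexClosedCurve ξ η ℓ) :
    Function.Periodic (curvature ξ η) ℓ := fun s => by
  simp only [curvature, h.periodic_fst.deriv_periodic s, h.periodic_snd.deriv_periodic s,
    h.periodic_fst.deriv_periodic.deriv_periodic s, h.periodic_snd.deriv_periodic.deriv_periodic s]

/-- This is the equality case of Cauchy–Schwarz for the unit vectors `(ξ', η')` and `(sin a, cos
a)`. -/
theorem tangent_eq_of_verticalSlope_eq (hu : ∀ s, deriv ξ s ^ 2 + deriv η s ^ 2 = 1)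
    (hσ : σ ^ 2 = 1) {a x : ℝ} (h : verticalSlope ξ η a x = σ) :
    deriv ξ x = σ * Real.sin a ∧ deriv η x = σ * Real.cos a := by
  unfold verticalSlope at h
  have key : (deriv ξ x - σ * Real.sin a) ^ 2 + (deriv η x - σ * Real.cos a) ^ 2 = 0 := by
    linear_combination hu x - 2 * σ * h - hσ + σ ^ 2 * Real.sin_sq_add_cos_sq a
  constructor <;> nlinarith [sq_nonneg (deriv ξ x - σ * Real.sin a),
    sq_nonneg (deriv η x - σ * Real.cos a)]

/-- The tangent at `s t` is `σ (sin φ, cos φ)`, so its angle is a constant minus `φ`; the curvature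
is the derivative of the angle in arc length. -/
theorem curvature_mul_deriv_of_verticalSlope_eq (h : IsStrictlyConvexClosedCurve ξ η ℓ)
    (hφ : ContDiff ℝ ∞ φ) (hs : ContDiff ℝ ∞ s) (hσ : σ ^ 2 = 1)
    (hv : ∀ t, verticalSlope ξ η (φ t) (s t) = σ) (t : ℝ) :
    curvature ξ η (s t) * deriv s t = -deriv φ t := by
  have ht := fun t => tangent_eq_of_verticalSlope_eq h.unit_speed hσ (hv t)
  have hsd := hs.hasDerivAt_infty t
  have hφd := hφ.hasDerivAt_infty t
  have e1 : deriv (deriv ξ) (s t) * deriv s t = σ * (Real.cos (φ t) * deriv φ t) := by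
    refine HasDerivAt.unique (f := fun t => deriv ξ (s t)) (x := t)
      ((h.smooth_fst.deriv_infty.hasDerivAt_infty (s t)).comp t hsd) ?_
    rw [funext fun t => (ht t).1]
    exact hφd.sin.const_mul σ
  have e2 : deriv (deriv η) (s t) * deriv s t = σ * (-Real.sin (φ t) * deriv φ t) := by
    refine HasDerivAt.unique (f := fun t => deriv η (s t)) (x := t)
      ((h.smooth_snd.deriv_infty.hasDerivAt_infty (s t)).comp t hsd) ?_
    rw [funext fun t => (ht t).2]
    exact hφd.cos.const_mul σ
  rw [curvature, (ht t).1, (ht t).2]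
  linear_combination σ * Real.sin (φ t) * e2 - σ * Real.cos (φ t) * e1 -
    (deriv φ t * (Real.sin (φ t) ^ 2 + Real.cos (φ t) ^ 2)) * hσ -
    deriv φ t * Real.sin_sq_add_cos_sq (φ t)

theorem periodic_of_verticalSlope_eq (h : IsStrictlyConvexClosedCurve ξ η ℓ)
    (hφ : ContDiff ℝ ∞ φ) {T : ℝ} (hφp : Function.Periodic φ T) (hs : ContDiff ℝ ∞ s)
    (hσ : σ ^ 2 = 1) (hv : ∀ t, verticalSlope ξ η (φ t) (s t) = σ) : Function.Periodic s T := by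
  -- `θ` is the tangent angle lifted to the line. Being injective there, it gives exact periodicity
  -- of `s`, not just modulo `ℓ`.
  let θ : ℝ → ℝ := fun x => ∫ y in (0 : ℝ)..x, curvature ξ η y
  have hκ := h.contDiff_curvature.continuous
  have hθ (x : ℝ) : HasDerivAt θ (curvature ξ η x) x :=
    integral_hasDerivAt_right (hκ.intervalIntegrable _ _)
      (hκ.stronglyMeasurableAtFilter _ _) hκ.continuousAt
  have hθd : deriv θ = curvature ξ η := funext fun x => (hθ x).deriv
  have hinj : Function.Injective θ := injective_of_deriv_ne_zero
    (by rwa [hθd]) (by rw [hθd]; exact h.curvature_ne_zero)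
  have hd (t : ℝ) : HasDerivAt (fun t => θ (s t) + φ t) 0 t := by
    refine (((hθ (s t)).comp t (hs.hasDerivAt_infty t)).add
      (hφ.hasDerivAt_infty t)).congr_deriv ?_
    rw [curvature_mul_deriv_of_verticalSlope_eq h hφ hs hσ hv]
    ring
  have hconst := is_const_of_deriv_eq_zero (fun t => (hd t).differentiableAt)
    fun t => (hd t).deriv
  intro t
  have := hconst (t + T) t
  rw [hφp] at this
  exact hinj (add_right_cancel this)

/-- Differentiating `κ s' = -φ'` gives `κ s'' = -φ'' - κ' s'^2`, and `|s'| ≤ B c`. The assumptions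
`c ≤ 1` and `1 ≤ B` merge the two terms into one. -/
theorem abs_deriv_deriv_le_of_verticalSlope_eq (h : IsStrictlyConvexClosedCurve ξ η ℓ)
    {B c : ℝ} (hB : 1 ≤ B) (hκ : ∀ x, |(curvature ξ η x)⁻¹| ≤ B)
    (hκ' : ∀ x, |deriv (curvature ξ η) x| ≤ B) (hc : c ≤ 1)
    (hφ : ContDiff ℝ ∞ φ) (hφ₁ : ∀ t, |deriv φ t| < c) (hφ₂ : ∀ t, |deriv (deriv φ) t| < c)
    (hs : ContDiff ℝ ∞ s) (hσ : σ ^ 2 = 1)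
    (hv : ∀ t, verticalSlope ξ η (φ t) (s t) = σ) (t : ℝ) :
    |deriv (deriv s) t| ≤ 2 * c * B ^ 4 := by
  have h1 := curvature_mul_deriv_of_verticalSlope_eq h hφ hs hσ hv
  have hne : curvature ξ η (s t) ≠ 0 := h.curvature_ne_zero _
  have hc0 : 0 < c := (abs_nonneg _).trans_lt (hφ₁ t)
  have h2 : deriv (curvature ξ η) (s t) * deriv s t * deriv s t +
      curvature ξ η (s t) * deriv (deriv s) t = -deriv (deriv φ) t := by
    refine HasDerivAt.unique (f := fun t => curvature ξ η (s t) * deriv s t) (x := t)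
      (((h.contDiff_curvature.hasDerivAt_infty (s t)).comp t (hs.hasDerivAt_infty t)).mul
        (hs.deriv_infty.hasDerivAt_infty t)) ?_
    rw [funext h1]
    exact (hφ.deriv_infty.hasDerivAt_infty t).neg
  have e1 : deriv s t = (curvature ξ η (s t))⁻¹ * -deriv φ t := by
    rw [← h1 t]; field_simp
  have e2 : deriv (deriv s) t = (curvature ξ η (s t))⁻¹ *
      (-deriv (deriv φ) t - deriv (curvature ξ η) (s t) * deriv s t ^ 2) := by
    rw [← h2]; field_simp; ring
  have b1 : |deriv s t| ≤ B * c := by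
    rw [e1, abs_mul, abs_neg]
    exact mul_le_mul (hκ _) (hφ₁ t).le (abs_nonneg _) (by linarith)
  have b2 : |deriv (curvature ξ η) (s t) * deriv s t ^ 2| ≤ B * (B * c) ^ 2 := by
    rw [abs_mul, abs_pow]
    exact mul_le_mul (hκ' _) (pow_le_pow_left₀ (abs_nonneg _) b1 2) (by positivity) (by linarith)
  have b3 : |(-deriv (deriv φ) t - deriv (curvature ξ η) (s t) * deriv s t ^ 2)| ≤
      c + B * (B * c) ^ 2 := by
    refine (abs_sub _ _).trans ?_
    rw [abs_neg]
    linarith [hφ₂ t]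
  rw [e2, abs_mul]
  refine (mul_le_mul (hκ _) b3 (abs_nonneg _) (by linarith)).trans ?_
  have p1 : B ≤ B ^ 4 := le_self_pow₀ hB (by norm_num)
  have p2 : c ^ 2 ≤ c := by nlinarith
  calc B * (c + B * (B * c) ^ 2) = c * B + c ^ 2 * B ^ 4 := by ring
    _ ≤ c * B ^ 4 + c * B ^ 4 := by gcongr
    _ = 2 * c * B ^ 4 := by ring

theorem contDiff_motionForce (hξ : ContDiff ℝ ∞ ξ) (hη : ContDiff ℝ ∞ η) (hφ : ContDiff ℝ ∞ φ) :
    ContDiff ℝ ∞ (Function.uncurry (motionForce ξ η φ)) := by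
  have h1 := hξ.deriv_infty
  have h2 := hη.deriv_infty
  have h3 := hφ.deriv_infty
  have h4 := h3.deriv_infty
  unfold Function.uncurry motionForce verticalSlope
  fun_prop

end

/-! ### Uniform bounds and the choice of constants -/

theorem exists_bound_of_curve {ξ η : ℝ → ℝ} {ℓ : ℝ} (h : IsStrictlyConvexClosedCurve ξ η ℓ) :
    ∃ B : ℝ, 1 ≤ B ∧ (∀ x, |(curvature ξ η x)⁻¹| ≤ B) ∧ (∀ x, |deriv (curvature ξ η) x| ≤ B) ∧
      (∀ x, |deriv (deriv ξ) x| ≤ B) ∧ (∀ x, |deriv (deriv η) x| ≤ B) ∧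
      (∀ x, |ξ x * deriv η x - η x * deriv ξ x| ≤ B) ∧
      (∀ x, |ξ x * deriv ξ x + η x * deriv η x| ≤ B) ∧
      (∀ x, |deriv (fun x => ξ x * deriv η x - η x * deriv ξ x) x| ≤ B) ∧
      ∀ x, |deriv (fun x => ξ x * deriv ξ x + η x * deriv η x) x| ≤ B := by
  have hℓ := h.length_pos.ne'
  have c1 := h.smooth_fst
  have c2 := h.smooth_snd
  have c1' := c1.deriv_infty
  have c2' := c2.deriv_infty
  have ca : ContDiff ℝ ∞ fun x => ξ x * deriv η x - η x * deriv ξ x := by fun_prop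
  have cb : ContDiff ℝ ∞ fun x => ξ x * deriv ξ x + η x * deriv η x := by fun_prop
  have p1 := h.periodic_fst
  have p2 := h.periodic_snd
  have p1' := p1.deriv_periodic
  have p2' := p2.deriv_periodic
  have pa : Function.Periodic (fun x => ξ x * deriv η x - η x * deriv ξ x) ℓ :=
    (p1.mul p2').sub (p2.mul p1')
  have pb : Function.Periodic (fun x => ξ x * deriv ξ x + η x * deriv η x) ℓ :=
    (p1.mul p1').add (p2.mul p2')
  have pk : Function.Periodic (fun x => (curvature ξ η x)⁻¹) ℓ := fun x => by
    simp only [h.curvature_periodic x]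
  obtain ⟨B₁, h₁⟩ := pk.exists_abs_le hℓ
    (h.contDiff_curvature.continuous.inv₀ h.curvature_ne_zero)
  obtain ⟨B₂, h₂⟩ := h.curvature_periodic.deriv_periodic.exists_abs_le hℓ
    h.contDiff_curvature.deriv_infty.continuous
  obtain ⟨B₃, h₃⟩ := p1'.deriv_periodic.exists_abs_le hℓ c1'.deriv_infty.continuous
  obtain ⟨B₄, h₄⟩ := p2'.deriv_periodic.exists_abs_le hℓ c2'.deriv_infty.continuous
  obtain ⟨B₅, h₅⟩ := pa.exists_abs_le hℓ ca.continuous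
  obtain ⟨B₆, h₆⟩ := pb.exists_abs_le hℓ cb.continuous
  obtain ⟨B₇, h₇⟩ := pa.deriv_periodic.exists_abs_le hℓ ca.deriv_infty.continuous
  obtain ⟨B₈, h₈⟩ := pb.deriv_periodic.exists_abs_le hℓ cb.deriv_infty.continuous
  have n₁ := (abs_nonneg _).trans (h₁ 0)
  have n₂ := (abs_nonneg _).trans (h₂ 0)
  have n₃ := (abs_nonneg _).trans (h₃ 0)
  have n₄ := (abs_nonneg _).trans (h₄ 0)
  have n₅ := (abs_nonneg _).trans (h₅ 0)
  have n₆ := (abs_nonneg _).trans (h₆ 0)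
  have n₇ := (abs_nonneg _).trans (h₇ 0)
  have n₈ := (abs_nonneg _).trans (h₈ 0)
  refine ⟨1 + B₁ + B₂ + B₃ + B₄ + B₅ + B₆ + B₇ + B₈, by linarith, fun x => (h₁ x).trans ?_,
    fun x => (h₂ x).trans ?_, fun x => (h₃ x).trans ?_, fun x => (h₄ x).trans ?_,
    fun x => (h₅ x).trans ?_, fun x => (h₆ x).trans ?_, fun x => (h₇ x).trans ?_,
    fun x => (h₈ x).trans ?_⟩ <;> linarith

/-- The force is a sum of four terms, each `B`-Lipschitz in `x`, and `4 B ≤ (2 B)^2` because `1 ≤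
B`. -/
theorem monotone_sub_motionForce {ξ η φ : ℝ → ℝ} (hξ : ContDiff ℝ ∞ ξ) (hη : ContDiff ℝ ∞ η)
    {B : ℝ} (hB : 1 ≤ B)
    (hξB : ∀ x, |deriv (deriv ξ) x| ≤ B) (hηB : ∀ x, |deriv (deriv η) x| ≤ B)
    (haB : ∀ x, |deriv (fun x => ξ x * deriv η x - η x * deriv ξ x) x| ≤ B)
    (hbB : ∀ x, |deriv (fun x => ξ x * deriv ξ x + η x * deriv η x) x| ≤ B)
    {t : ℝ} (hφ₁ : |deriv φ t| ≤ 1) (hφ₂ : |deriv (deriv φ) t| ≤ 1) :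
    Monotone fun x => (2 * B) ^ 2 * x - motionForce ξ η φ t x := by
  intro x y hxy
  have c1 := hξ.deriv_infty
  have c2 := hη.deriv_infty
  have product_le {p d : ℝ} (hp : |p| ≤ 1) (hd : |d| ≤ B * (y - x)) : p * d ≤ B * (y - x) :=
    calc p * d ≤ |p * d| := le_abs_self _
      _ = |p| * |d| := abs_mul _ _
      _ ≤ 1 * (B * (y - x)) := mul_le_mul hp hd (abs_nonneg _) zero_le_one
      _ = B * (y - x) := one_mul _
  have l1 := product_le (Real.abs_sin_le_one (φ t)) (abs_sub_le_of_abs_deriv_le c1 hξB hxy)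
  have l2 := product_le (Real.abs_cos_le_one (φ t)) (abs_sub_le_of_abs_deriv_le c2 hηB hxy)
  have l3 := product_le (p := -deriv (deriv φ) t) (by rwa [abs_neg])
    (abs_sub_le_of_abs_deriv_le (by fun_prop) haB hxy)
  have l4 := product_le (p := deriv φ t ^ 2)
    (by rw [abs_pow]; exact pow_le_one₀ (abs_nonneg _) hφ₁)
    (abs_sub_le_of_abs_deriv_le (by fun_prop) hbB hxy)
  have l5 : 4 * (B * (y - x)) ≤ (2 * B) ^ 2 * (y - x) := by
    have : B ≤ B ^ 2 := le_self_pow₀ hB (by norm_num)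
    nlinarith [sub_nonneg.2 hxy]
  simp only [motionForce, verticalSlope]
  linarith

theorem lemma3p7 (ξ η : ℝ → ℝ) (ℓ : ℝ) (hcurve : IsStrictlyConvexClosedCurve ξ η ℓ) :
    ∃ c : ℝ, 0 < c ∧
      ∀ (T : ℝ) (φ : ℝ → ℝ), 0 < T → ContDiff ℝ ∞ φ → Function.Periodic φ T →
        (∀ t, |deriv φ t| < c ∧ |deriv (deriv φ) t| < c) →
        ∀ s₁ s₂ : ℝ → ℝ, IsVerticalTangentPair ξ η φ s₁ s₂ →
          ∃ s : ℝ → ℝ, IsRotatingCurveSolution ξ η φ s ∧ Function.Periodic s T ∧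
            ∀ t, s₁ t < s t ∧ s t < s₂ t := by
  obtain ⟨B, hB, hκ, hκ', hξB, hηB, ha, hb, ha', hb'⟩ := exists_bound_of_curve hcurve
  have hB4 : 1 ≤ B ^ 4 := one_le_pow₀ hB
  have hBB4 : B ≤ B ^ 4 := le_self_pow₀ hB (by norm_num)
  -- With this choice the acceleration bound `2 c B^4` equals `1/4` and each of the two perturbing
  -- terms of the force is at most `1/8`. The total error `1/2` stays below the slope `1`.
  set c : ℝ := 1 / (8 * B ^ 4) with hcdef
  have hc0 : 0 < c := by positivity
  have hcB : c * B ^ 4 = 1 / 8 := by rw [hcdef]; field_simp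
  have hc1 : c ≤ 1 := by nlinarith
  refine ⟨c, hc0, fun T φ hT hφ hφp hφc s₁ s₂ hs => ?_⟩
  have hφ₁ := fun t => (hφc t).1
  have hφ₂ := fun t => (hφc t).2
  have perturbation_le (t x : ℝ) :
      |motionForce ξ η φ t x - verticalSlope ξ η (φ t) x| ≤ 1 / 4 := by
    have e1 : |deriv (deriv φ) t * (ξ x * deriv η x - η x * deriv ξ x)| ≤ c * B := by
      rw [abs_mul]; exact mul_le_mul (hφ₂ t).le (ha x) (abs_nonneg _) hc0.le
    have e2 : |deriv φ t ^ 2 * (ξ x * deriv ξ x + η x * deriv η x)| ≤ c ^ 2 * B := by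
      rw [abs_mul, abs_pow]
      exact mul_le_mul (pow_le_pow_left₀ (abs_nonneg _) (hφ₁ t).le 2) (hb x) (abs_nonneg _)
        (by positivity)
    have e3 : c * B ≤ 1 / 8 := by rw [← hcB]; gcongr
    have e4 : c ^ 2 * B ≤ 1 / 8 := by nlinarith
    rw [abs_le] at e1 e2 ⊢
    unfold motionForce
    constructor <;> linarith [e1.1, e1.2, e2.1, e2.2]
  have acceleration_le {σ : ℝ} {s : ℝ → ℝ} (hσ : σ ^ 2 = 1) (hsm : ContDiff ℝ ∞ s)
      (hv : ∀ t, verticalSlope ξ η (φ t) (s t) = σ) (t : ℝ) : |deriv (deriv s) t| ≤ 1 / 4 := by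
    have := abs_deriv_deriv_le_of_verticalSlope_eq hcurve hB hκ hκ' hc1 hφ hφ₁ hφ₂ hsm hσ hv t
    linarith
  have hσ₁ : (-1 : ℝ) ^ 2 = 1 := by norm_num
  have hσ₂ : (1 : ℝ) ^ 2 = 1 := by norm_num
  obtain ⟨u, hu, hueq, hup, hub⟩ := exists_periodic_solution_between (m := 2 * B) (by linarith) hT
    (contDiff_motionForce hcurve.smooth_fst hcurve.smooth_snd hφ)
    (fun t x => by
      simp only [motionForce, hφp t, hφp.deriv_periodic t, hφp.deriv_periodic.deriv_periodic t])
    (fun t => monotone_sub_motionForce hcurve.smooth_fst hcurve.smooth_snd hB hξB hηB ha' hb'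
      ((hφ₁ t).le.trans hc1) ((hφ₂ t).le.trans hc1))
    hs.smooth_left.hasDerivAt_infty hs.smooth_left.deriv_infty.hasDerivAt_infty
    hs.smooth_right.hasDerivAt_infty hs.smooth_right.deriv_infty.hasDerivAt_infty
    (periodic_of_verticalSlope_eq hcurve hφ hφp hs.smooth_left hσ₁ hs.left_eq)
    (periodic_of_verticalSlope_eq hcurve hφ hφp hs.smooth_right hσ₂ hs.right_eq)
    (fun t => by
      -- The force at `s₁` is at most `-1 + 1/4`, below `-1/4 ≤ s₁''`; the situation at `s₂` is
      -- symmetric.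
      have e1 := abs_le.1 (perturbation_le t (s₁ t))
      have e2 := abs_le.1 (acceleration_le hσ₁ hs.smooth_left hs.left_eq t)
      linarith [hs.left_eq t, e1.2, e2.1])
    (fun t => by
      have e1 := abs_le.1 (perturbation_le t (s₂ t))
      have e2 := abs_le.1 (acceleration_le hσ₂ hs.smooth_right hs.right_eq t)
      linarith [hs.right_eq t, e1.1, e2.2])
    (fun t => (hs.lt t).le)
  refine ⟨u, ⟨hu, fun t => ?_⟩, hup, hub⟩
  rw [hueq, motionForce]
  ring
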